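/- Let $n$ battlefields have values $w_1,\dots,w_n>0$, with $W=\sum_b w_b$, and let $q>0$ and $R_B>0$. For $P,R_A\ge 0$ consider the following two-stage General Lotto game. In stage 1, player $A$ chooses a pre-allocation $p\in\Delta_n(P)=\{p\in\mathbb{R}_{\ge0}^n:\sum_b p_b=P\}$, which becomes known to player $B$. In stage 2, the players simultaneously choose probability distributions $F_A,F_B$ on $\mathbb{R}_{\ge 0}^n$ with $\mathbb{E}_{x_A\sim F_A}\big[\sum_b x_{A,b}\big]\le R_A$ and $\mathbb{E}_{x_B\sim F_B}\big[\sum_b x_{B,b}\big]\le R_B$; the allocations $x_A\sim F_A$ and $x_B\sim F_B$ are drawn independently, and player $A$ wins battlefield $b$ if $x_{A,b}+p_b>q\,x_{B,b}$, while player $B$ wins it otherwise. Each player's payoff is the expected total value of the battlefields won. Let $\pi_A^*(P,R_A,R_B)$ be the maximum over $p\in\Delta_n(P)$ of player $A$'s (Nash) equilibrium payoff in the stage-2 game with pre-allocation $p$. Let $0\le\Pi<W$. Then for $P,R_A\ge0$, the payoff $\pi_A^*(P,R_A,R_B)$ equals $\Pi$ if and only if one of the following holds: 1. $\Pi<\frac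 W2$, $\;P<\dfrac{qR_B(W-2\Pi)}{W-\Pi}$ and $R_A=\dfrac{2\Pi}{W}(qR_B-P)$; 2. $\dfrac{qR_B(W-2\Pi)}{W-\Pi}\le P\le\dfrac{qR_BW}{W-\Pi}$ and $R_A=\dfrac{\big(qR_BW-(W-\Pi)P\big)^2}{2qR_B(W-\Pi)W}$. (When $\Pi\ge W/2$, the lower bound on $P$ in 2 is nonpositive, so that case 2 covers $0\le P\le qR_BW/(W-\Pi)$.) Moreover, if $P>\dfrac{qR_BW}{W-\Pi}$, then $\pi_A^*(P,R_A,R_B)>\Pi$ for every $R_A\ge0$. -/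

import Mathlib

open MeasureTheory

namespace GeneralLotto

/-- An admissible mixed allocation of real-time resources with budget `R`: a (Borel) probability
distribution on `ℝⁿ`, concentrated on `ℝ₊ⁿ`, whose expected total allocation is finite and at
most `R`. -/
structure IsStrategy {n : ℕ} (R : ℝ) (F : Measure (Fin n → ℝ)) : Prop where
  prob : IsProbabilityMeasure F
  nonneg : ∀ᵐ x ∂F, ∀ b, 0 ≤ x b
  integrable : Integrable (fun x : Fin n → ℝ => ∑ b, x b) F
  budget : ∫ x, ∑ b, x b ∂F ≤ R

open Classical in
/-- The winning indicator `I(a, b)`: it is `1` if `a > b` and `0` otherwise. -/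
noncomputable def win (a b : ℝ) : ℝ := if b < a then 1 else 0

/-- Expected payoff of player `A`: the players draw `x_A ∼ F_A` and `x_B ∼ F_B` independently and
`A` receives `w_b` on each battlefield `b` with `x_{A,b} + p_b > q x_{B,b}`. -/
noncomputable def payoffA {n : ℕ} (w p : Fin n → ℝ) (q : ℝ)
    (FA FB : Measure (Fin n → ℝ)) : ℝ :=
  ∫ z : (Fin n → ℝ) × (Fin n → ℝ), ∑ b, w b * win (z.1 b + p b) (q * z.2 b) ∂(FA.prod FB)

/-- Expected payoff of player `B`, who wins every battlefield that `A` does not win. -/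
noncomputable def payoffB {n : ℕ} (w p : Fin n → ℝ) (q : ℝ)
    (FA FB : Measure (Fin n → ℝ)) : ℝ :=
  ∑ b, w b - payoffA w p q FA FB

/-- `(FA, FB)` is an equilibrium of the simultaneous-move second stage, the General Lotto game with
favoritism in which `A` has the pre-allocation profile `p`. -/
structure IsEquilibrium {n : ℕ} (w p : Fin n → ℝ) (q RA RB : ℝ)
    (FA FB : Measure (Fin n → ℝ)) : Prop where
  stratA : IsStrategy RA FA
  stratB : IsStrategy RB FB
  bestA : ∀ F, IsStrategy RA F → payoffA w p q F FB ≤ payoffA w p q FA FB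
  bestB : ∀ F, IsStrategy RB F → payoffB w p q FA F ≤ payoffB w p q FA FB

/-- `v` is an equilibrium payoff of player `A` in the second stage with pre-allocation `p`. -/
def IsStageTwoPayoff {n : ℕ} (w p : Fin n → ℝ) (q RA RB v : ℝ) : Prop :=
  ∃ FA FB, IsEquilibrium w p q RA RB FA FB ∧ payoffA w p q FA FB = v

/-- The pre-allocation profiles `Δₙ(P)`: nonnegative vectors with total `P`. -/
def preAllocations (n : ℕ) (P : ℝ) : Set (Fin n → ℝ) :=
  {p | (∀ b, 0 ≤ p b) ∧ ∑ b, p b = P}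

/-- `v` is the equilibrium payoff of player `A` in the two-stage game: the maximum, over the
pre-allocations `p ∈ Δₙ(P)` of the first stage, of `A`'s equilibrium payoff in the second stage.
There is at most one such `v`, as a set of reals has at most one greatest element. -/
def IsEquilibriumPayoff {n : ℕ} (w : Fin n → ℝ) (q P RA RB v : ℝ) : Prop :=
  IsGreatest {u | ∃ p ∈ preAllocations n P, IsStageTwoPayoff w p q RA RB u} v

end GeneralLotto

namespace GeneralLotto

/-! ### The payoff integrand -/

/-! Each stage-2 game is constant-sum, so matching guarantees suffice. For any `p`, `B` can with
probability `x` allocate `p / q` plus a uniform multiple of `w`. The offset cancels the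
pre-allocation, so `A`'s payoff is bounded by an affine function of the total spent, and the bound
depends on `p` only through `P` (`exists_strategyB`). With `p` proportional to `w`, `A` has a
symmetric lottery that bounds `B` affinely (`exists_strategyA`). Suitable parameters make the two
bounds coincide on each level curve, which proves the "if" direction.

Every `(P, RA)` lies on the level curve of some `v` in `[0, W)` (`exists_onLevelCurve`), and a
greatest element is unique. This gives the converse, and also the last claim, since a level curve of
value `v` stops at `P = q * RB * W / (W - v)`. -/

lemma win_nonneg (a b : ℝ) : 0 ≤ win a b := by
  unfold win; split_ifs <;> norm_num

lemma win_le_one (a b : ℝ) : win a b ≤ 1 := by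
  unfold win; split_ifs <;> norm_num

lemma measurable_win : Measurable fun y : ℝ × ℝ => win y.1 y.2 := by
  classical
  unfold win
  exact Measurable.ite (measurableSet_lt measurable_snd measurable_fst)
    measurable_const measurable_const

lemma measurable_win_comp {α : Type*} [MeasurableSpace α] {f g : α → ℝ} (hf : Measurable f)
    (hg : Measurable g) : Measurable fun y => win (f y) (g y) :=
  measurable_win.comp (hf.prodMk hg)

lemma integrable_win {α : Type*} [MeasurableSpace α] {μ : Measure α} [IsFiniteMeasure μ]
    {f g : α → ℝ} (hf : Measurable f) (hg : Measurable g) :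
    Integrable (fun y => win (f y) (g y)) μ := by
  refine Integrable.of_bound (measurable_win_comp hf hg).aestronglyMeasurable 1 (.of_forall fun y => ?_)
  rw [Real.norm_of_nonneg (win_nonneg _ _)]
  exact win_le_one _ _

variable {n : ℕ}

lemma integrable_prod_payoff (w p : Fin n → ℝ) (q : ℝ) (FA FB : Measure (Fin n → ℝ))
    [IsProbabilityMeasure FA] [IsProbabilityMeasure FB] :
    Integrable (fun z : (Fin n → ℝ) × (Fin n → ℝ) =>
      ∑ b, w b * win (z.1 b + p b) (q * z.2 b)) (FA.prod FB) :=
  integrable_finsetSum _ fun b _ =>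
    (integrable_win (by fun_prop) (by fun_prop)).const_mul (w b)

lemma payoffA_eq_integral_left (w p : Fin n → ℝ) (q : ℝ) (FA FB : Measure (Fin n → ℝ))
    [IsProbabilityMeasure FA] [IsProbabilityMeasure FB] :
    payoffA w p q FA FB
      = ∫ x, ∑ b, w b * ∫ z, win (x b + p b) (q * z b) ∂FB ∂FA := by
  rw [payoffA, integral_prod _ (integrable_prod_payoff w p q FA FB)]
  refine integral_congr_ae (.of_forall fun x => ?_)
  dsimp only
  rw [integral_finsetSum _ fun b _ =>
    (integrable_win (by fun_prop) (by fun_prop)).const_mul (w b)]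
  simp only [integral_const_mul]

lemma payoffA_eq_integral_right (w p : Fin n → ℝ) (q : ℝ) (FA FB : Measure (Fin n → ℝ))
    [IsProbabilityMeasure FA] [IsProbabilityMeasure FB] :
    payoffA w p q FA FB
      = ∫ z, ∑ b, w b * ∫ x, win (x b + p b) (q * z b) ∂FA ∂FB := by
  rw [payoffA, integral_prod_symm _ (integrable_prod_payoff w p q FA FB)]
  refine integral_congr_ae (.of_forall fun x => ?_)
  dsimp only
  rw [integral_finsetSum _ fun b _ =>
    (integrable_win (by fun_prop) (by fun_prop)).const_mul (w b)]
  simp only [integral_const_mul]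

lemma integrable_inner_left (w p : Fin n → ℝ) (q : ℝ) (FA FB : Measure (Fin n → ℝ))
    [IsProbabilityMeasure FA] [IsProbabilityMeasure FB] :
    Integrable (fun x => ∑ b, w b * ∫ z, win (x b + p b) (q * z b) ∂FB) FA := by
  have h := (integrable_prod_payoff w p q FA FB).integral_prod_left
  refine h.congr (.of_forall fun x => ?_)
  dsimp only
  rw [integral_finsetSum _ fun b _ =>
    (integrable_win (by fun_prop) (by fun_prop)).const_mul (w b)]
  simp only [integral_const_mul]

lemma integrable_inner_right (w p : Fin n → ℝ) (q : ℝ) (FA FB : Measure (Fin n → ℝ))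
    [IsProbabilityMeasure FA] [IsProbabilityMeasure FB] :
    Integrable (fun z => ∑ b, w b * ∫ x, win (x b + p b) (q * z b) ∂FA) FB := by
  have h := (integrable_prod_payoff w p q FA FB).integral_prod_right
  refine h.congr (.of_forall fun x => ?_)
  dsimp only
  rw [integral_finsetSum _ fun b _ =>
    (integrable_win (by fun_prop) (by fun_prop)).const_mul (w b)]
  simp only [integral_const_mul]

/-! ### Guarantees from affine bounds on the conditional payoff -/

lemma payoffA_le_of_affine_bound {w p : Fin n → ℝ} {q R α l : ℝ} {FA FB : Measure (Fin n → ℝ)}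
    [IsProbabilityMeasure FB] (hF : IsStrategy R FA) (hl : 0 ≤ l)
    (h : ∀ᵐ x ∂FA, ∑ b, w b * ∫ z, win (x b + p b) (q * z b) ∂FB ≤ α + l * ∑ b, x b) :
    payoffA w p q FA FB ≤ α + l * R := by
  have := hF.prob
  rw [payoffA_eq_integral_left]
  calc _ ≤ ∫ x, α + l * ∑ b, x b ∂FA :=
        integral_mono_ae (integrable_inner_left w p q FA FB)
          ((integrable_const α).add (hF.integrable.const_mul l)) h
    _ = α + l * ∫ x, ∑ b, x b ∂FA := by
        rw [integral_add (integrable_const α) (hF.integrable.const_mul l), integral_const_mul]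
        simp
    _ ≤ α + l * R := by gcongr; exact hF.budget

lemma le_payoffA_of_affine_bound {w p : Fin n → ℝ} {q R α l : ℝ} {FA FB : Measure (Fin n → ℝ)}
    [IsProbabilityMeasure FA] (hF : IsStrategy R FB) (hl : 0 ≤ l)
    (h : ∀ᵐ z ∂FB, α - l * ∑ b, z b ≤ ∑ b, w b * ∫ x, win (x b + p b) (q * z b) ∂FA) :
    α - l * R ≤ payoffA w p q FA FB := by
  have := hF.prob
  rw [payoffA_eq_integral_right]
  calc α - l * R ≤ α - l * ∫ x, ∑ b, x b ∂FB := by gcongr; exact hF.budget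
    _ = ∫ x, α - l * ∑ b, x b ∂FB := by
        rw [integral_sub (integrable_const α) (hF.integrable.const_mul l), integral_const_mul]
        simp
    _ ≤ _ := integral_mono_ae ((integrable_const α).sub (hF.integrable.const_mul l))
          (integrable_inner_right w p q FA FB) h

/-- With a zero budget, nothing is allocated almost surely. -/
lemma IsStrategy.ae_eq_zero {F : Measure (Fin n → ℝ)} (hF : IsStrategy 0 F) :
    ∀ᵐ x ∂F, ∀ b, x b = 0 := by
  have h0 : ∀ᵐ x ∂F, 0 ≤ ∑ b, x b := by
    filter_upwards [hF.nonneg] with x hx using Finset.sum_nonneg fun b _ => hx b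
  have h1 : ∫ x, ∑ b, x b ∂F = 0 := le_antisymm hF.budget (integral_nonneg_of_ae h0)
  filter_upwards [(integral_eq_zero_iff_of_nonneg_ae h0 hF.integrable).1 h1, hF.nonneg]
    with x hx hx0 b
  exact (Finset.sum_eq_zero_iff_of_nonneg fun b _ => hx0 b).1 hx b (Finset.mem_univ b)

/-! ### Mixtures of the zero allocation and a uniformly distributed allocation on a segment -/

/-- The distribution that allocates nothing with probability `1 - c` and is otherwise uniform on
the segment from `u` to `u + v`. -/
noncomputable def segmentLottery (c : ℝ) (u v : Fin n → ℝ) : Measure (Fin n → ℝ) :=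
  ENNReal.ofReal (1 - c) • Measure.dirac 0 +
    ENNReal.ofReal c • (volume.restrict (Set.Icc (0 : ℝ) 1)).map fun s b => u b + s * v b

instance isProbabilityMeasure_unitInterval :
    IsProbabilityMeasure (volume.restrict (Set.Icc (0 : ℝ) 1)) :=
  ⟨by simp⟩

lemma measurable_segment (u v : Fin n → ℝ) :
    Measurable fun (s : ℝ) (b : Fin n) => u b + s * v b := by fun_prop

lemma isProbabilityMeasure_segmentLottery {c : ℝ} (hc0 : 0 ≤ c) (hc1 : c ≤ 1) (u v : Fin n → ℝ) :
    IsProbabilityMeasure (segmentLottery c u v) := by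
  have := Measure.isProbabilityMeasure_map (μ := volume.restrict (Set.Icc (0 : ℝ) 1))
    (measurable_segment u v).aemeasurable
  refine ⟨?_⟩
  simp only [segmentLottery, Measure.add_apply, Measure.smul_apply, measure_univ, smul_eq_mul,
    mul_one]
  rw [← ENNReal.ofReal_add (by linarith) hc0]
  simp

lemma integrable_segmentLottery (c : ℝ) {u v : Fin n → ℝ} {f : (Fin n → ℝ) → ℝ}
    (hf : Measurable f)
    (hi : IntegrableOn (fun s : ℝ => f fun b => u b + s * v b) (Set.Icc 0 1)) :
    Integrable f (segmentLottery c u v) := by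
  refine Integrable.add_measure ?_ ?_
  · exact (integrable_dirac (by simp)).smul_measure ENNReal.ofReal_ne_top
  · refine Integrable.smul_measure ?_ ENNReal.ofReal_ne_top
    exact (integrable_map_measure hf.aestronglyMeasurable
      (measurable_segment u v).aemeasurable).2 hi

lemma integral_segmentLottery {c : ℝ} (hc0 : 0 ≤ c) (hc1 : c ≤ 1) {u v : Fin n → ℝ}
    {f : (Fin n → ℝ) → ℝ} (hf : Measurable f)
    (hi : IntegrableOn (fun s : ℝ => f fun b => u b + s * v b) (Set.Icc 0 1)) :
    ∫ x, f x ∂segmentLottery c u v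
      = (1 - c) * f 0 + c * ∫ s in Set.Icc (0 : ℝ) 1, f fun b => u b + s * v b := by
  rw [segmentLottery, integral_add_measure, integral_smul_measure, integral_smul_measure,
    integral_dirac, integral_map (measurable_segment u v).aemeasurable hf.aestronglyMeasurable,
    ENNReal.toReal_ofReal (by linarith), ENNReal.toReal_ofReal hc0, smul_eq_mul, smul_eq_mul]
  · exact (integrable_dirac (by simp)).smul_measure ENNReal.ofReal_ne_top
  · refine Integrable.smul_measure ?_ ENNReal.ofReal_ne_top
    exact (integrable_map_measure hf.aestronglyMeasurable
      (measurable_segment u v).aemeasurable).2 hi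

lemma isStrategy_segmentLottery {c R : ℝ} (hc0 : 0 ≤ c) (hc1 : c ≤ 1) {u v : Fin n → ℝ}
    (hu : ∀ b, 0 ≤ u b) (hv : ∀ b, 0 ≤ v b) (hR : c * (∑ b, u b + (∑ b, v b) / 2) ≤ R) :
    IsStrategy R (segmentLottery c u v) := by
  have hm : Measurable fun x : Fin n → ℝ => ∑ b, x b := by fun_prop
  have hi : IntegrableOn (fun s : ℝ => ∑ b, (u b + s * v b)) (Set.Icc 0 1) :=
    (Continuous.continuousOn (by fun_prop)).integrableOn_compact isCompact_Icc
  refine ⟨isProbabilityMeasure_segmentLottery hc0 hc1 u v, ?_,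
    integrable_segmentLottery c hm hi, ?_⟩
  · have hs : MeasurableSet {x : Fin n → ℝ | ∀ b, 0 ≤ x b} := by
      simp only [Set.ofPred_forall]
      exact MeasurableSet.iInter fun b => measurableSet_le measurable_const (measurable_pi_apply b)
    rw [segmentLottery, ae_add_measure_iff]
    refine ⟨Measure.ae_smul_measure ?_ _, Measure.ae_smul_measure ?_ _⟩
    · rw [ae_dirac_iff hs]; simp
    · rw [ae_map_iff (measurable_segment u v).aemeasurable hs]
      refine (ae_restrict_iff' measurableSet_Icc).2 (.of_forall fun s hs b => ?_)
      exact add_nonneg (hu b) (mul_nonneg hs.1 (hv b))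
  · rw [integral_segmentLottery hc0 hc1 hm hi]
    have h : ∫ s in Set.Icc (0 : ℝ) 1, ∑ b, (u b + s * v b) = ∑ b, u b + (∑ b, v b) / 2 := by
      rw [integral_Icc_eq_integral_Ioc, ← intervalIntegral.integral_of_le zero_le_one]
      simp_rw [Finset.sum_add_distrib, ← Finset.mul_sum]
      rw [intervalIntegral.integral_add (by simp) (Continuous.intervalIntegrable (by fun_prop) _ _)]
      simp
      ring
    rw [h]
    simpa using hR

/-! ### Winning probabilities against a uniformly distributed allocation -/

/-- A uniform variable on `[0, l]` lies below `a` with probability at most `a / l`. The product form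
remains meaningful at `l = 0`. -/
lemma mul_integral_win_le {a l : ℝ} (ha : 0 ≤ a) (hl : 0 ≤ l) :
    l * ∫ s in Set.Icc (0 : ℝ) 1, win a (s * l) ≤ a := by
  classical
  rcases hl.eq_or_lt with rfl | hl
  · simpa using ha
  have h : (fun s : ℝ => win a (s * l)) = (Set.Iio (a / l)).indicator 1 := by
    funext s
    simp [win, Set.indicator_apply, lt_div_iff₀ hl]
  rw [h, integral_indicator_one measurableSet_Iio, measureReal_restrict_apply measurableSet_Iio]
  have h2 : volume.real (Set.Iio (a / l) ∩ Set.Icc 0 1) ≤ a / l := by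
    calc _ ≤ volume.real (Set.Ico 0 (a / l)) :=
          measureReal_mono (fun s hs => ⟨hs.2.1, hs.1⟩) (by simp)
      _ = a / l := by simp [Real.volume_real_Ico_of_le (div_nonneg ha hl.le)]
  calc _ ≤ l * (a / l) := by gcongr
    _ = a := by field_simp

lemma mul_one_sub_integral_win_le {r l : ℝ} (hr : 0 ≤ r) (hl : 0 ≤ l) :
    l * (1 - ∫ s in Set.Icc (0 : ℝ) 1, win (s * l) r) ≤ r := by
  classical
  rcases hl.eq_or_lt with rfl | hl
  · simpa using hr
  have h : 1 - ∫ s in Set.Icc (0 : ℝ) 1, win (s * l) r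
      = ∫ s in Set.Icc (0 : ℝ) 1, (Set.Iic (r / l)).indicator 1 s := by
    have h1 : ∫ s in Set.Icc (0 : ℝ) 1, (1 - win (s * l) r)
        = 1 - ∫ s in Set.Icc (0 : ℝ) 1, win (s * l) r := by
      rw [integral_sub (integrable_const _) (integrable_win (by fun_prop) (by fun_prop))]
      simp
    rw [← h1]
    congr 1
    funext s
    by_cases hs : s ≤ r / l
    · have := (le_div_iff₀ hl).1 hs
      simp [win, hs, this]
    · have := (div_lt_iff₀ hl).1 (not_le.1 hs)
      simp [win, hs, this]
  rw [h, integral_indicator_one measurableSet_Iic, measureReal_restrict_apply measurableSet_Iic]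
  have h2 : volume.real (Set.Iic (r / l) ∩ Set.Icc 0 1) ≤ r / l := by
    calc _ ≤ volume.real (Set.Icc 0 (r / l)) :=
          measureReal_mono (fun s hs => ⟨hs.2.1, hs.1⟩) (by simp)
      _ = r / l := by simp [Real.volume_real_Icc_of_le (div_nonneg hr hl.le)]
  calc _ ≤ l * (r / l) := by gcongr
    _ = r := by field_simp

/-! ### The guarantees of the two players -/

/-- Whatever the pre-allocation, `B` can hold `A` down to `W (1 - x + x R_A / L)`. -/
lemma exists_strategyB {w p : Fin n → ℝ} (hw : ∀ b, 0 < w b) {q P RA RB W x L : ℝ} (hq : 0 < q)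
    (hW : W = ∑ b, w b) (hW0 : 0 < W) (hp : p ∈ preAllocations n P)
    (hx0 : 0 ≤ x) (hx1 : x ≤ 1) (hL : 0 ≤ L) (hL0 : L = 0 → RA = 0)
    (hbudget : x * (P + L / 2) ≤ q * RB) :
    ∃ FB, IsStrategy RB FB ∧
      ∀ FA, IsStrategy RA FA → payoffA w p q FA FB ≤ W * (1 - x + x * (RA / L)) := by
  obtain ⟨hp0, hpP⟩ := hp
  have hprob := isProbabilityMeasure_segmentLottery hx0 hx1
    (fun b => p b / q) (fun b => L * (w b / W) / q)
  refine ⟨segmentLottery x (fun b => p b / q) (fun b => L * (w b / W) / q),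
    isStrategy_segmentLottery hx0 hx1 (fun b => div_nonneg (hp0 b) hq.le)
      (fun b => div_nonneg (mul_nonneg hL (div_nonneg (hw b).le hW0.le)) hq.le) ?_, ?_⟩
  · rw [← Finset.sum_div, ← Finset.sum_div, ← Finset.mul_sum, ← Finset.sum_div, hpP, ← hW,
      div_self hW0.ne']
    calc x * (P / q + L * 1 / q / 2) = x * (P + L / 2) / q := by ring
      _ ≤ RB := by rw [div_le_iff₀ hq]; linarith
  intro FA hFA
  have key : ∀ y : Fin n → ℝ, (∀ b, 0 ≤ y b) → (L = 0 → ∀ b, y b = 0) →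
      ∑ b, w b * ∫ z, win (y b + p b) (q * z b)
        ∂segmentLottery x (fun b => p b / q) (fun b => L * (w b / W) / q)
      ≤ W * (1 - x) + W * x / L * ∑ b, y b := by
    intro y hy hyL
    have hterm : ∀ b, w b * ∫ z, win (y b + p b) (q * z b)
        ∂segmentLottery x (fun b => p b / q) (fun b => L * (w b / W) / q)
        ≤ w b * (1 - x) + W * x / L * y b := by
      intro b
      rw [integral_segmentLottery hx0 hx1
        (f := fun z : Fin n → ℝ => win (y b + p b) (q * z b))
        (measurable_win_comp (by fun_prop) (by fun_prop))
        (integrable_win (by fun_prop) (by fun_prop))]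
      -- The offset `p b / q` exactly neutralizes the pre-allocation.
      have hrw : (fun s : ℝ => win (y b + p b) (q * (p b / q + s * (L * (w b / W) / q))))
          = fun s => win (y b) (s * (L * (w b / W))) := by
        funext s
        have : q * (p b / q + s * (L * (w b / W) / q)) = s * (L * (w b / W)) + p b := by
          field_simp; ring
        rw [this]
        simp [win]
      rw [hrw]
      have h1 : (1 - x) * win (y b + p b) (q * (0 : Fin n → ℝ) b) ≤ (1 - x) * 1 :=
        mul_le_mul_of_nonneg_left (win_le_one _ _) (by linarith)
      set I := ∫ s in Set.Icc (0 : ℝ) 1, win (y b) (s * (L * (w b / W))) with hI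
      have h2 : w b * I ≤ W / L * y b := by
        -- For `L = 0` the opponents tie at `y b = 0`, and ties go to `B`.
        rcases hL.eq_or_lt with h0 | h0
        · have : I = 0 := by simp [hI, ← h0, hyL h0.symm b, win]
          simp [this, ← h0]
        · have := mul_integral_win_le (hy b)
            (mul_nonneg hL (div_nonneg (hw b).le hW0.le))
          rw [← hI] at this
          calc w b * I = W / L * (L * (w b / W) * I) := by field_simp
            _ ≤ W / L * y b := by gcongr
      calc _ = w b * ((1 - x) * win (y b + p b) (q * (0 : Fin n → ℝ) b)) + x * (w b * I) := by ring
        _ ≤ w b * ((1 - x) * 1) + x * (W / L * y b) := by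
          have := (hw b).le
          gcongr
        _ = _ := by ring
    calc _ ≤ ∑ b, (w b * (1 - x) + W * x / L * y b) := Finset.sum_le_sum fun b _ => hterm b
      _ = _ := by rw [Finset.sum_add_distrib, ← Finset.sum_mul, ← Finset.mul_sum, ← hW]
  have hae : ∀ᵐ y ∂FA, ∑ b, w b * ∫ z, win (y b + p b) (q * z b)
      ∂segmentLottery x (fun b => p b / q) (fun b => L * (w b / W) / q)
      ≤ W * (1 - x) + W * x / L * ∑ b, y b := by
    by_cases h0 : L = 0
    · have hz : IsStrategy 0 FA := by rw [← hL0 h0]; exact hFA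
      filter_upwards [hFA.nonneg, hz.ae_eq_zero] with y hy hy0 using key y hy fun _ => hy0
    · filter_upwards [hFA.nonneg] with y hy using key y hy fun h => absurd h h0
  calc _ ≤ W * (1 - x) + W * x / L * RA := payoffA_le_of_affine_bound hFA (by positivity) hae
    _ = _ := by ring

/-- With the pre-allocation proportional to the values, `A` can secure `W (1 - β - μ q R_B)`. -/
lemma exists_strategyA {w : Fin n → ℝ} (hw : ∀ b, 0 < w b) {q P RA RB W c L β μ : ℝ} (hq : 0 < q)
    (hW : W = ∑ b, w b) (hW0 : 0 < W) (hc0 : 0 ≤ c) (hc1 : c ≤ 1) (hL : 0 ≤ L)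
    (hβ : 0 ≤ β) (hμ : 0 ≤ μ) (hm : 1 - c ≤ β + μ * P) (hcL : c ≤ μ * L)
    (hbudget : c * (L / 2) ≤ RA) :
    ∃ FA, IsStrategy RA FA ∧ ∀ FB, IsStrategy RB FB →
      W * (1 - β - μ * (q * RB)) ≤ payoffA w (fun b => P * (w b / W)) q FA FB := by
  have hprob := isProbabilityMeasure_segmentLottery hc0 hc1
    (0 : Fin n → ℝ) (fun b => L * (w b / W))
  refine ⟨segmentLottery c 0 (fun b => L * (w b / W)),
    isStrategy_segmentLottery hc0 hc1 (fun b => le_rfl)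
      (fun b => mul_nonneg hL (div_nonneg (hw b).le hW0.le)) ?_, ?_⟩
  · rw [← Finset.mul_sum, ← Finset.sum_div, ← hW, div_self hW0.ne']
    simpa using hbudget
  intro FB hFB
  have key : ∀ z : Fin n → ℝ, (∀ b, 0 ≤ z b) →
      W * (1 - β) - μ * W * q * ∑ b, z b ≤
      ∑ b, w b * ∫ x, win (x b + P * (w b / W)) (q * z b)
        ∂segmentLottery c 0 (fun b => L * (w b / W)) := by
    intro z hz
    have hterm : ∀ b, w b * (1 - β) - μ * W * q * z b ≤
        w b * ∫ x, win (x b + P * (w b / W)) (q * z b)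
        ∂segmentLottery c 0 (fun b => L * (w b / W)) := by
      intro b
      have hwb := hw b
      rw [integral_segmentLottery hc0 hc1
        (f := fun x : Fin n → ℝ => win (x b + P * (w b / W)) (q * z b))
        (measurable_win_comp (by fun_prop) (by fun_prop))
        (integrable_win (by fun_prop) (by fun_prop))]
      simp only [Pi.zero_apply, zero_add]
      have hqz : 0 ≤ q * z b := mul_nonneg hq.le (hz b)
      -- Below the pre-allocation `B` never wins, so `β, μ ≥ 0` suffices. At it, `B`'s winning
      -- probability may jump to `1 - c`, covered by `hm`; beyond it, growth is controlled by `hcL`.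
      rcases lt_or_ge (q * z b) (P * (w b / W)) with hlt | hge
      · have hI : ∫ s in Set.Icc (0 : ℝ) 1,
            win (s * (L * (w b / W)) + P * (w b / W)) (q * z b) = 1 := by
          rw [setIntegral_congr_fun (g := fun _ => (1 : ℝ)) measurableSet_Icc]
          · simp
          · intro s hs
            have : 0 ≤ s * (L * (w b / W)) :=
              mul_nonneg hs.1 (mul_nonneg hL (div_nonneg hwb.le hW0.le))
            exact if_pos (by linarith)
        rw [hI, win, if_pos hlt]
        have : 0 ≤ μ * W * (q * z b) := by positivity
        nlinarith [mul_nonneg hwb.le hβ]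
      · have hr : 0 ≤ q * z b - P * (w b / W) := sub_nonneg.2 hge
        have hrw : (fun s : ℝ => win (s * (L * (w b / W)) + P * (w b / W)) (q * z b))
            = fun s => win (s * (L * (w b / W))) (q * z b - P * (w b / W)) := by
          funext s
          simp [win, sub_lt_iff_lt_add]
        rw [hrw]
        have h2 := mul_one_sub_integral_win_le hr
          (mul_nonneg hL (div_nonneg hwb.le hW0.le))
        set I := ∫ s in Set.Icc (0 : ℝ) 1,
          win (s * (L * (w b / W))) (q * z b - P * (w b / W)) with hI
        have hI1 : I ≤ 1 := by
          calc I ≤ ∫ s in Set.Icc (0 : ℝ) 1, (1 : ℝ) :=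
                integral_mono (integrable_win (by fun_prop) (by fun_prop)) (integrable_const _)
                  fun s => win_le_one _ _
            _ = 1 := by simp
        have h3 : w b * (c * (1 - I)) ≤ μ * (W * (q * z b) - P * w b) := by
          calc w b * (c * (1 - I)) ≤ w b * (μ * L * (1 - I)) := by
                have : 0 ≤ 1 - I := by linarith
                gcongr
            _ = μ * W * (L * (w b / W) * (1 - I)) := by field_simp
            _ ≤ μ * W * (q * z b - P * (w b / W)) := by gcongr
            _ = _ := by field_simp
        have h4 : 0 ≤ w b * ((1 - c) * win (P * (w b / W)) (q * z b)) :=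
          mul_nonneg hwb.le (mul_nonneg (by linarith) (win_nonneg _ _))
        have h5 := mul_le_mul_of_nonneg_left hm hwb.le
        linarith
    calc _ = ∑ b, (w b * (1 - β) - μ * W * q * z b) := by
          rw [Finset.sum_sub_distrib, ← Finset.sum_mul, ← Finset.mul_sum, ← hW]
      _ ≤ _ := Finset.sum_le_sum fun b _ => hterm b
  calc _ = W * (1 - β) - μ * W * q * RB := by ring
    _ ≤ _ := le_payoffA_of_affine_bound hFB (by positivity)
      (by filter_upwards [hFB.nonneg] with z hz using key z hz)

/-- Matching guarantees of the two players determine the equilibrium payoff. -/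
lemma isEquilibriumPayoff_of_guarantees {w : Fin n → ℝ} {q P RA RB v : ℝ} {p₀ : Fin n → ℝ}
    (hp₀ : p₀ ∈ preAllocations n P)
    (hA : ∃ FA, IsStrategy RA FA ∧ ∀ FB, IsStrategy RB FB → v ≤ payoffA w p₀ q FA FB)
    (hB : ∀ p ∈ preAllocations n P, ∃ FB, IsStrategy RB FB ∧
      ∀ FA, IsStrategy RA FA → payoffA w p q FA FB ≤ v) :
    IsEquilibriumPayoff w q P RA RB v := by
  constructor
  · obtain ⟨FA, hFA, hA⟩ := hA
    obtain ⟨FB, hFB, hB⟩ := hB p₀ hp₀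
    have heq : payoffA w p₀ q FA FB = v := le_antisymm (hB FA hFA) (hA FB hFB)
    refine ⟨p₀, hp₀, FA, FB, ⟨hFA, hFB, fun F hF => ?_, fun F hF => ?_⟩, heq⟩
    · rw [heq]; exact hB F hF
    · have := hA F hF
      unfold payoffB
      linarith
  -- In any equilibrium, under any `p`, `B` could deviate to the guarantee `FB'`.
  · rintro u ⟨p, hp, FA, FB, hE, rfl⟩
    obtain ⟨FB', hFB', hB⟩ := hB p hp
    have h1 := hE.bestB FB' hFB'
    have h2 := hB FA hE.stratA
    unfold payoffB at h1
    linarith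

/-- Reduces the game to algebra: `x, L` describe the lottery of `B`, `c, L` that of `A`, and `β, μ`
the affine majorant of `B`'s winning probability. -/
lemma isEquilibriumPayoff_of_parameters {w : Fin n → ℝ} (hw : ∀ b, 0 < w b)
    {q P RA RB W v x c L β μ : ℝ} (hq : 0 < q) (hP : 0 ≤ P)
    (hW : W = ∑ b, w b) (hW0 : 0 < W) (hL : 0 ≤ L)
    (hx0 : 0 ≤ x) (hx1 : x ≤ 1) (hL0 : L = 0 → RA = 0) (hbB : x * (P + L / 2) ≤ q * RB)
    (hvB : W * (1 - x + x * (RA / L)) = v)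
    (hc0 : 0 ≤ c) (hc1 : c ≤ 1) (hβ : 0 ≤ β) (hμ : 0 ≤ μ) (hm : 1 - c ≤ β + μ * P)
    (hcL : c ≤ μ * L) (hbA : c * (L / 2) ≤ RA) (hvA : W * (1 - β - μ * (q * RB)) = v) :
    IsEquilibriumPayoff w q P RA RB v := by
  refine isEquilibriumPayoff_of_guarantees (p₀ := fun b => P * (w b / W)) ⟨fun b => ?_, ?_⟩ ?_ ?_
  · exact mul_nonneg hP (div_nonneg (hw b).le hW0.le)
  · rw [← Finset.mul_sum, ← Finset.sum_div, ← hW, div_self hW0.ne', mul_one]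
  · rw [← hvA]
    exact exists_strategyA hw hq hW hW0 hc0 hc1 hL hβ hμ hm hcL hbA
  · intro p hp
    rw [← hvB]
    exact exists_strategyB hw hq hW hW0 hp hx0 hx1 hL hL0 hbB

/-! ### The level curves of the equilibrium payoff -/

/-- The points `(P, R_A)` of the level curve of value `v`, where `B = q R_B`. -/
def OnLevelCurve (W B P RA v : ℝ) : Prop :=
  (v < W / 2 ∧ P < B * (W - 2 * v) / (W - v) ∧ RA = 2 * v / W * (B - P)) ∨
    (B * (W - 2 * v) / (W - v) ≤ P ∧ P ≤ B * W / (W - v) ∧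
      RA = (B * W - (W - v) * P) ^ 2 / (2 * B * (W - v) * W))

lemma OnLevelCurve.isEquilibriumPayoff {w : Fin n → ℝ} (hw : ∀ b, 0 < w b)
    {q P RA RB W v : ℝ} (hq : 0 < q) (hRB : 0 < RB) (hP : 0 ≤ P)
    (hW : W = ∑ b, w b) (hv0 : 0 ≤ v) (hvW : v < W) (h : OnLevelCurve W (q * RB) P RA v) :
    IsEquilibriumPayoff w q P RA RB v := by
  have hW0 : 0 < W := hv0.trans_lt hvW
  have hB : 0 < q * RB := mul_pos hq hRB
  generalize hBd : q * RB = B at h hB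
  have hd : 0 < W - v := sub_pos.2 hvW
  rcases h with ⟨h1, h2, rfl⟩ | ⟨h1, h2, rfl⟩
  · rw [lt_div_iff₀ hd] at h2
    have hBP : 0 < B - P := by nlinarith [mul_nonneg hB.le hv0]
    -- `B` always competes: `x = 1` and a tight budget fix `L`, and `A`'s budget fixes `c`. The
    -- majorant is tight: `μ = c / L` and `1 - c = β + μ * P`.
    refine isEquilibriumPayoff_of_parameters hw (x := 1) (c := 2 * v / W) (L := 2 * (B - P))
      (β := 1 - 2 * v / W - v / W / (B - P) * P) (μ := v / W / (B - P))
      hq hP hW hW0 (by positivity) zero_le_one le_rfl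
      (fun h => absurd h (by positivity)) (by rw [hBd]; linarith) ?_ (by positivity)
      ?_ ?_ (by positivity) (by linarith) ?_ (le_of_eq (by ring)) ?_
    · field_simp; ring
    · rw [div_le_one hW0]; linarith
    · have : 1 - 2 * v / W - v / W / (B - P) * P
          = ((W - 2 * v) * (B - P) - v * P) / (W * (B - P)) := by field_simp
      rw [this]
      apply div_nonneg _ (by positivity)
      linarith
    · apply le_of_eq; field_simp
    · rw [hBd]; field_simp; ring
  · rw [le_div_iff₀ hd] at h2
    rw [div_le_iff₀ hd] at h1
    have hs : 0 < B * W + (W - v) * P := by positivity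
    -- Now `β = 0`, so tightness gives `μ = 1 / (P + L)` and `c = L / (P + L)`. The value `v` forces
    -- `P + L = B * W / (W - v)`, and `B`'s budget gives `x = B / (P + L / 2)`.
    refine isEquilibriumPayoff_of_parameters hw (x := 2 * B * (W - v) / (B * W + (W - v) * P))
      (c := (B * W - (W - v) * P) / (B * W)) (L := (B * W - (W - v) * P) / (W - v))
      (β := 0) (μ := (W - v) / (B * W))
      hq hP hW hW0 (div_nonneg (by linarith) hd.le) (by positivity) ?_ ?_ ?_ ?_
      (div_nonneg (by linarith) (by positivity)) ?_ le_rfl (by positivity) ?_ ?_ ?_ ?_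
    · rw [div_le_one hs]; linarith
    · intro h
      rw [div_eq_zero_iff, or_iff_left hd.ne'] at h
      simp [h]
    · rw [hBd]; apply le_of_eq; field_simp; ring
    · have : (B * W - (W - v) * P) ^ 2 / (2 * B * (W - v) * W) /
          ((B * W - (W - v) * P) / (W - v)) = (B * W - (W - v) * P) / (2 * B * W) := by
        rcases eq_or_ne (B * W - (W - v) * P) 0 with h | h
        · simp [h]
        · field_simp
      rw [this]; field_simp; ring
    · rw [div_le_one (by positivity)]
      have := mul_nonneg hd.le hP
      linarith
    · apply le_of_eq; field_simp; ring
    · apply le_of_eq; field_simp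
    · apply le_of_eq; field_simp
    · rw [hBd]; field_simp; ring

lemma OnLevelCurve.le_div {W B P RA v : ℝ} (hB : 0 ≤ B) (hv0 : 0 ≤ v) (hvW : v < W)
    (h : OnLevelCurve W B P RA v) : P ≤ B * W / (W - v) := by
  rcases h with ⟨-, h, -⟩ | ⟨-, h, -⟩
  · refine h.le.trans ?_
    have := sub_pos.2 hvW
    gcongr
    linarith
  · exact h

lemma exists_onLevelCurve {W B P RA : ℝ} (hW : 0 < W) (hB : 0 < B) (hP : 0 ≤ P) (hRA : 0 ≤ RA) :
    ∃ v, 0 ≤ v ∧ v < W ∧ OnLevelCurve W B P RA v := by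
  -- Solving the linear equation of the first branch for `v` turns its bound on `P` into this
  -- inequality.
  by_cases h : P < B ∧ RA * (2 * B - P) < 2 * (B - P) ^ 2
  · obtain ⟨h1, h2⟩ := h
    have hBP : 0 < B - P := sub_pos.2 h1
    have hlt : RA < B - P := by
      by_contra! hc
      nlinarith
    have hv : W * RA / (2 * (B - P)) < W / 2 := by
      rw [div_lt_div_iff₀ (by positivity) two_pos]
      nlinarith
    refine ⟨W * RA / (2 * (B - P)), by positivity, by linarith, Or.inl ⟨hv, ?_, ?_⟩⟩
    · rw [lt_div_iff₀ (by linarith)]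
      have e : B * (W - 2 * (W * RA / (2 * (B - P)))) - P * (W - W * RA / (2 * (B - P)))
          = W / (2 * (B - P)) * (2 * (B - P) ^ 2 - RA * (2 * B - P)) := by
        field_simp; ring
      have : 0 < W / (2 * (B - P)) * (2 * (B - P) ^ 2 - RA * (2 * B - P)) :=
        mul_pos (by positivity) (by linarith)
      linarith
    · field_simp
  -- With `D = B * W / (W - v)`, the second branch reads `(D - P) ^ 2 = 2 * D * RA`, whose larger
  -- root is `P + RA + s`. Its lower bound on `P` becomes `2 * B ≤ P + D`, which is `hge`.
  · set s := √(RA ^ 2 + 2 * P * RA) with hs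
    have hs0 : 0 ≤ s := Real.sqrt_nonneg _
    have hs2 : s ^ 2 = RA ^ 2 + 2 * P * RA := Real.sq_sqrt (by positivity)
    have hge : 2 * (B - P) ≤ RA + s := by
      rcases le_or_gt B P with hBP | hBP
      · linarith
      · have h2 : 2 * (B - P) ^ 2 ≤ RA * (2 * B - P) := not_lt.1 fun hc => h ⟨hBP, hc⟩
        by_contra! hc
        have : s ^ 2 < (2 * (B - P) - RA) ^ 2 := by
          apply pow_lt_pow_left₀ _ hs0 two_ne_zero
          linarith
        nlinarith
    obtain ⟨D, hD⟩ : ∃ D, D = P + RA + s := ⟨_, rfl⟩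
    have hDB : B ≤ D := by
      rcases le_or_gt B P with hBP | hBP <;> linarith
    have hD0 : 0 < D := hB.trans_le hDB
    have hDeq : (D - P) ^ 2 = 2 * D * RA := by rw [hD]; linear_combination hs2
    have hWv : W - W * (1 - B / D) = W * B / D := by ring
    refine ⟨W * (1 - B / D), mul_nonneg hW.le ?_, ?_, Or.inr ⟨?_, ?_, ?_⟩⟩
    · rw [sub_nonneg, div_le_one hD0]; exact hDB
    · have : 0 < W * B / D := by positivity
      linarith
    · rw [hWv, div_le_iff₀ (by positivity)]
      have e : P * (W * B / D) - B * (W - 2 * (W * (1 - B / D)))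
          = W * B / D * (P + D - 2 * B) := by field_simp; ring
      have : 0 ≤ W * B / D * (P + D - 2 * B) := mul_nonneg (by positivity) (by linarith)
      linarith
    · rw [hWv]
      have : B * W / (W * B / D) = D := by field_simp
      rw [this]; linarith
    · rw [hWv]
      have : (B * W - W * B / D * P) ^ 2 / (2 * B * (W * B / D) * W) = (D - P) ^ 2 / (2 * D) := by
        field_simp
      rw [this, hDeq]
      field_simp

end GeneralLotto

open GeneralLotto in
theorem mainTheorem2 {n : ℕ} (w : Fin n → ℝ) (hw : ∀ b, 0 < w b)
    (q : ℝ) (hq : 0 < q) (RB : ℝ) (hRB : 0 < RB)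
    (W : ℝ) (hW : W = ∑ b, w b) (Pi : ℝ) (hPi0 : 0 ≤ Pi) (hPiW : Pi < W) :
    (∀ P RA : ℝ, 0 ≤ P → 0 ≤ RA →
      (GeneralLotto.IsEquilibriumPayoff w q P RA RB Pi ↔
        (Pi < W / 2 ∧ P < q * RB * (W - 2 * Pi) / (W - Pi) ∧
          RA = 2 * Pi / W * (q * RB - P)) ∨
        (q * RB * (W - 2 * Pi) / (W - Pi) ≤ P ∧ P ≤ q * RB * W / (W - Pi) ∧
          RA = (q * RB * W - (W - Pi) * P) ^ 2 / (2 * (q * RB) * (W - Pi) * W)))) ∧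
    (∀ P RA : ℝ, q * RB * W / (W - Pi) < P → 0 ≤ RA →
      ∃ v, GeneralLotto.IsEquilibriumPayoff w q P RA RB v ∧ Pi < v) := by
  have hW0 : 0 < W := hPi0.trans_lt hPiW
  have hB : 0 < q * RB := mul_pos hq hRB
  have hd : 0 < W - Pi := sub_pos.2 hPiW
  refine ⟨fun P RA hP hRA => ⟨fun h => ?_, fun h => ?_⟩, fun P RA hP hRA => ?_⟩
  · obtain ⟨v, hv0, hvW, hv⟩ := exists_onLevelCurve hW0 hB hP hRA
    have : Pi = v := h.unique (hv.isEquilibriumPayoff hw hq hRB hP hW hv0 hvW)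
    rw [this]
    exact hv
  · exact OnLevelCurve.isEquilibriumPayoff hw hq hRB hP hW hPi0 hPiW h
  · have hP0 : 0 ≤ P := le_trans (by positivity) hP.le
    obtain ⟨v, hv0, hvW, hv⟩ := exists_onLevelCurve hW0 hB hP0 hRA
    refine ⟨v, hv.isEquilibriumPayoff hw hq hRB hP0 hW hv0 hvW, ?_⟩
    have h := hP.trans_le (hv.le_div hB.le hv0 hvW)
    -- The endpoint `B * W / (W - v)` is increasing in `v`, so comparing endpoints compares values.
    rw [div_lt_div_iff_of_pos_left (by positivity) hd (sub_pos.2 hvW)] at h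
    linarith
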